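/- For $x\in\mathbb{R}^d$ let $x^\downarrow$ be the vector of its entries rearranged in non-increasing order. For $x,y\in\mathbb{R}^d$ write $x\prec y$ ($x$ is majorized by $y$) if $\sum_{i=1}^{j}x_i^\downarrow\le\sum_{i=1}^{j}y_i^\downarrow$ for every $1\le j\le d$ and $\sum_{i=1}^{d}x_i=\sum_{i=1}^{d}y_i$. For a complex $d\times d$ matrix $M$ with only real eigenvalues let $\lambda(M)\in\mathbb{R}^d$ be the vector of its eigenvalues, counted with algebraic multiplicity and arranged in non-increasing order; $\log\lambda(M)$ is taken entrywise when the eigenvalues are positive. Theorem 3.5. Let $A,B$ be positive definite complex $d\times d$ matrices such that $$\log\lambda(A^{-1}B)\neq\bigl(\log\lambda(B)-\log\lambda(A)\bigr)^\downarrow .$$ Then there exist $t_0>0$ and a continuous curve $\gamma:(-t_0,t_0)\to\mathcal{U}(d)$ in the group of $d\times d$ unitary matrices such that $\gamma(0)=I$ and, for every $t\in(-t_0,t_0)$ with $t\neq0$, $$\log\lambda(A^{-1}\gamma(t)B\gamma(t)^*)\neq\log\lambda(A^{-1}B)\quad\text{and}\quad\log\lambda(A^{-1}\gamma(t)B\gamma(t)^*)\prec\log\lambda(A^{-1}B).$$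 -/

import Mathlib

open scoped ComplexOrder Matrix

/-- The vector `x↓`: the entries of `x` rearranged in non-increasing order. -/
noncomputable def sortDesc {d : ℕ} (x : Fin d → ℝ) : Fin d → ℝ :=
  fun i => x (Tuple.sort x (Fin.rev i))

/-- `x` is submajorized by `y`: each partial sum of `x↓` is at most that of `y↓`. -/
def Submajorized {d : ℕ} (x y : Fin d → ℝ) : Prop :=
  ∀ j : Fin d, ∑ i ∈ Finset.Iic j, sortDesc x i ≤ ∑ i ∈ Finset.Iic j, sortDesc y i

/-- `x` is majorized by `y`: submajorized, with equal total sums. -/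
def Majorized {d : ℕ} (x y : Fin d → ℝ) : Prop :=
  Submajorized x y ∧ ∑ i, x i = ∑ i, y i

/-- The real parts of the roots of the characteristic polynomial of `M`, with multiplicity,
in non-increasing order. -/
noncomputable def eigenvalueList {d : ℕ} (M : Matrix (Fin d) (Fin d) ℂ) : List ℝ :=
  (M.charpoly.roots.map Complex.re).sort (· ≥ ·)

theorem length_eigenvalueList {d : ℕ} (M : Matrix (Fin d) (Fin d) ℂ) :
    (eigenvalueList M).length = d := by
  rw [eigenvalueList, Multiset.length_sort, Multiset.card_map,
    ← (IsAlgClosed.splits M.charpoly).natDegree_eq_card_roots,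
    Matrix.charpoly_natDegree_eq_dim, Fintype.card_fin]

/-- The eigenvalues `λ(M)` of a complex `d × d` matrix `M` all of whose eigenvalues are real,
counted with (algebraic) multiplicity and arranged in non-increasing order. Hermitian matrices
and products of two positive definite matrices have only real eigenvalues, so that the real
parts in `eigenvalueList` are the eigenvalues themselves. -/
noncomputable def eigenvaluesDesc {d : ℕ} (M : Matrix (Fin d) (Fin d) ℂ) : Fin d → ℝ :=
  fun i => (eigenvalueList M).get (i.cast (length_eigenvalueList M).symm)

/-- The vector `log λ(M)`, the logarithm being taken entrywise. -/
noncomputable def logEigenvalues {d : ℕ} (M : Matrix (Fin d) (Fin d) ℂ) : Fin d → ℝ :=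
  fun i => Real.log (eigenvaluesDesc M i)

/-! Everything is phrased with the multiset of log-eigenvalues and the convex functions `u ↦ max (u
- s) 0`, since this form is additive over diagonal blocks. Two mechanisms produce the curve.

If `A` and `B` do not commute, a Hermitian non-scalar matrix commuting with both splits them into
smaller blocks, at least one of which still fails to commute; this leaves the irreducible case
(`improvable_of_irreducible`). Write `A⁻¹ = W * Wᴴ`, so that `A⁻¹ * B` has the spectrum of `Wᴴ * B *
W`. Irreducibility makes the linearized orbit map surjective (`eq_zero_of_orthogonal_orbit`), hence
every spectrum of the same determinant close to the original one is reached by rotating `B`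
slightly, continuously in the target. The targets contract the log-eigenvalues towards their mean.
These are not all equal, since otherwise `B` would be a multiple of `A`.

If `A` and `B` commute, they are diagonalized together. When their eigenvalues are similarly
ordered, the excluded equality holds (`logEigenvalues_eq_sortDesc`). Otherwise two indices are
oppositely ordered, and rotating their plane lowers the trace of `A⁻¹ * B` at fixed determinant
(`improvable_diagonal_fin_two`), which for two eigenvalues means strict majorization. -/

/-! ### Majorization of multisets -/

/-- Strict majorization of finite multisets of reals, expressed through the convex functions
`u ↦ max (u - s) 0`. -/
structure StrictlyMajorized (x y : Multiset ℝ) : Prop where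
  ne : x ≠ y
  sum_eq : x.sum = y.sum
  sum_max_le : ∀ s : ℝ, (x.map fun u => max (u - s) 0).sum ≤ (y.map fun u => max (u - s) 0).sum

theorem StrictlyMajorized.add_right {x y : Multiset ℝ} (h : StrictlyMajorized x y)
    (z : Multiset ℝ) : StrictlyMajorized (x + z) (y + z) where
  ne := fun e => h.ne (add_right_cancel e)
  sum_eq := by simp [h.sum_eq]
  sum_max_le s := by simpa using h.sum_max_le s

theorem sortDesc_antitone {d : ℕ} (x : Fin d → ℝ) : Antitone (sortDesc x) := fun _ _ h =>
  Tuple.monotone_sort x (Fin.rev_le_rev.2 h)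

theorem sum_comp_sortDesc {d : ℕ} (x : Fin d → ℝ) (f : ℝ → ℝ) :
    ∑ i, f (sortDesc x i) = ∑ i, f (x i) :=
  Equiv.sum_comp (Fin.revPerm.trans (Tuple.sort x)) fun i => f (x i)

theorem submajorized_of_sum_max_le {d : ℕ} {x y : Fin d → ℝ}
    (h : ∀ s : ℝ, ∑ i, max (x i - s) 0 ≤ ∑ i, max (y i - s) 0) : Submajorized x y := by
  intro j
  -- At this threshold the positive parts for `y` add up exactly to the first entries of `y↓` minus
  -- `s`; for `x` they only bound the corresponding sum from above.
  set s := sortDesc y j with hs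
  have hy : ∑ i ∈ Finset.Iic j, (sortDesc y i - s) = ∑ i, max (y i - s) 0 := by
    rw [← sum_comp_sortDesc y fun u => max (u - s) 0]
    rw [← Finset.sum_subset (Finset.subset_univ (Finset.Iic j))]
    · refine Finset.sum_congr rfl fun i hi => (max_eq_left ?_).symm
      exact sub_nonneg.2 (sortDesc_antitone y (Finset.mem_Iic.1 hi))
    · intro i _ hi
      refine max_eq_right (sub_nonpos.2 (sortDesc_antitone y ?_))
      exact (not_le.1 (fun h => hi (Finset.mem_Iic.2 h))).le
  have hx : ∑ i ∈ Finset.Iic j, (sortDesc x i - s) ≤ ∑ i, max (x i - s) 0 := by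
    rw [← sum_comp_sortDesc x fun u => max (u - s) 0]
    refine (Finset.sum_le_sum fun i _ => le_max_left (sortDesc x i - s) 0).trans ?_
    exact Finset.sum_le_univ_sum_of_nonneg fun i => le_max_right _ _
  have := hx.trans ((h s).trans hy.ge)
  simpa [Finset.sum_sub_distrib] using this

theorem sum_map_univ {n : Type} [Fintype n] (x : n → ℝ) (f : ℝ → ℝ) :
    ((Finset.univ.val.map x).map f).sum = ∑ i, f (x i) := by
  rw [Multiset.map_map]; rfl

theorem StrictlyMajorized.majorized {d : ℕ} {x y : Fin d → ℝ}
    (h : StrictlyMajorized (Finset.univ.val.map x) (Finset.univ.val.map y)) :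
    x ≠ y ∧ Majorized x y := by
  refine ⟨fun e => h.ne (by rw [e]), submajorized_of_sum_max_le fun s => ?_, h.sum_eq⟩
  simpa only [sum_map_univ] using h.sum_max_le s

/-- Convexity of `max (· - s) 0` bounds each term; Jensen's inequality at the mean `c` absorbs the
part weighted by `t`. -/
theorem sum_max_le_of_combination {n : Type} [Fintype n] [Nonempty n] (x : n → ℝ) {t : ℝ}
    (h0 : 0 ≤ t) (h1 : t ≤ 1) {c : ℝ} (hc : Fintype.card n * c = ∑ i, x i) (s : ℝ) :
    ∑ i, max ((1 - t) * x i + t * c - s) 0 ≤ ∑ i, max (x i - s) 0 := by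
  have hN : (0 : ℝ) < Fintype.card n := by exact_mod_cast Fintype.card_pos
  have hmean : Fintype.card n * max (c - s) 0 ≤ ∑ i, max (x i - s) 0 := by
    rw [mul_max_of_nonneg _ _ hN.le, mul_zero]
    refine max_le ?_ (Finset.sum_nonneg fun i _ => le_max_right _ _)
    rw [mul_sub, hc]
    refine le_trans (le_of_eq ?_) (Finset.sum_le_sum fun i _ => le_max_left (x i - s) 0)
    simp
  calc ∑ i, max ((1 - t) * x i + t * c - s) 0
      ≤ ∑ i, ((1 - t) * max (x i - s) 0 + t * max (c - s) 0) := by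
        refine Finset.sum_le_sum fun i _ => max_le ?_ ?_
        · nlinarith [le_max_left (x i - s) 0, le_max_left (c - s) 0]
        · have := le_max_right (x i - s) 0
          have := le_max_right (c - s) 0
          have : 0 ≤ 1 - t := by linarith
          positivity
    _ = (1 - t) * ∑ i, max (x i - s) 0 + t * (Fintype.card n * max (c - s) 0) := by
        rw [Finset.sum_add_distrib, ← Finset.mul_sum]
        simp; ring
    _ ≤ (1 - t) * ∑ i, max (x i - s) 0 + t * ∑ i, max (x i - s) 0 := by gcongr
    _ = _ := by ring

theorem strictlyMajorized_combination {n : Type} [Fintype n] [Nonempty n] (x : n → ℝ) {t : ℝ}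
    (h0 : 0 < t) (h1 : t < 1) {c : ℝ} (hc : Fintype.card n * c = ∑ i, x i)
    (hx : ∃ i, x i ≠ c) :
    StrictlyMajorized (Finset.univ.val.map fun i => (1 - t) * x i + t * c)
      (Finset.univ.val.map x) where
  ne e := by
    -- The sum of squared deviations from `c` is positive and shrinks by the factor `(1 - t) ^ 2 <
    -- 1`.
    have h := congrArg (fun m : Multiset ℝ => (m.map fun u => (u - c) ^ 2).sum) e
    simp only [sum_map_univ] at h
    have h2 : ∑ i, ((1 - t) * x i + t * c - c) ^ 2 = (1 - t) ^ 2 * ∑ i, (x i - c) ^ 2 := by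
      rw [Finset.mul_sum]
      exact Finset.sum_congr rfl fun i _ => by ring
    obtain ⟨i, hi⟩ := hx
    have h3 : 0 < ∑ i, (x i - c) ^ 2 :=
      Finset.sum_pos' (fun i _ => sq_nonneg _) ⟨i, Finset.mem_univ _, by
        have := sub_ne_zero.2 hi; positivity⟩
    rw [h2] at h
    nlinarith [mul_pos (mul_pos h0 (by linarith : 0 < 2 - t)) h3]
  sum_eq := by
    change ∑ i, ((1 - t) * x i + t * c) = ∑ i, x i
    rw [Finset.sum_add_distrib, ← Finset.mul_sum, ← hc]
    simp; ring
  sum_max_le s := by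
    simpa only [sum_map_univ] using sum_max_le_of_combination x h0.le h1.le hc s

/-- For pairs with a fixed sum, strict convexity makes the sum of exponentials increase with the
spread, so it decides the majorization. -/
theorem strictlyMajorized_pair {p q u v : ℝ} (hsum : p + q = u + v)
    (hexp : Real.exp p + Real.exp q < Real.exp u + Real.exp v) :
    StrictlyMajorized {p, q} {u, v} := by
  wlog hpq : q ≤ p generalizing p q
  · rw [Multiset.pair_comm p q]
    exact this (by linarith) (by linarith) (by linarith)
  wlog huv : v ≤ u generalizing u v
  · rw [Multiset.pair_comm u v]
    exact this (by linarith) (by linarith) (by linarith)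
  have hpu : p < u := by
    by_contra! hup
    -- If `u ≤ p`, the tangents of `exp` at `u` and `v`, with `p - u = v - q`, would give the
    -- reverse of `hexp`.
    have h1 : Real.exp u * (p - u) ≤ Real.exp p - Real.exp u := by
      have := mul_le_mul_of_nonneg_left (Real.add_one_le_exp (p - u)) (Real.exp_pos u).le
      rw [← Real.exp_add, add_sub_cancel] at this
      linarith
    have h2 : Real.exp v - Real.exp q ≤ Real.exp v * (v - q) := by
      have := mul_le_mul_of_nonneg_left (Real.add_one_le_exp (q - v)) (Real.exp_pos v).le
      rw [← Real.exp_add, add_sub_cancel] at this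
      linarith
    have h3 : Real.exp v * (v - q) ≤ Real.exp u * (p - u) := by
      rw [show v - q = p - u by linarith]
      exact mul_le_mul_of_nonneg_right (Real.exp_le_exp.2 huv) (sub_nonneg.2 hup)
    linarith
  refine ⟨fun e => ?_, by simpa using hsum, fun s => ?_⟩
  · have : p ∈ ({u, v} : Multiset ℝ) := e ▸ by simp
    rcases (by simpa using this : p = u ∨ p = v) with h | h <;> linarith
  · simp only [Multiset.insert_eq_cons, Multiset.map_cons, Multiset.map_singleton,
      Multiset.sum_cons, Multiset.sum_singleton]
    rcases max_cases (p - s) 0 with h1 | h1 <;> rcases max_cases (q - s) 0 with h2 | h2 <;>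
      linarith [le_max_left (u - s) 0, le_max_left (v - s) 0, le_max_right (u - s) 0,
        le_max_right (v - s) 0]

/-! ### Spectra -/

/-- The logarithms of the eigenvalues of a matrix with positive eigenvalues. -/
noncomputable def logSpectrum {n : Type} [Fintype n] [DecidableEq n] (M : Matrix n n ℂ) :
    Multiset ℝ :=
  M.charpoly.roots.map fun z => Real.log z.re

theorem map_logEigenvalues {d : ℕ} (M : Matrix (Fin d) (Fin d) ℂ) :
    Finset.univ.val.map (logEigenvalues M) = logSpectrum M := by
  have h : List.ofFn (eigenvaluesDesc M) = eigenvalueList M := by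
    refine List.ext_get (by simp [length_eigenvalueList]) fun i h1 h2 => ?_
    simp [eigenvaluesDesc]
  have h2 : (Finset.univ.val.map (eigenvaluesDesc M)) = M.charpoly.roots.map Complex.re := by
    rw [Fin.univ_val_map, h, eigenvalueList, Multiset.sort_eq]
  have h3 := congrArg (Multiset.map Real.log) h2
  rwa [Multiset.map_map, Multiset.map_map] at h3

theorem roots_charpoly_diagonal {n : Type} [Fintype n] [DecidableEq n] (x : n → ℂ) :
    (Matrix.diagonal x).charpoly.roots = Finset.univ.val.map x := by
  rw [Matrix.charpoly_diagonal, ← Polynomial.roots_multiset_prod_X_sub_C (Finset.univ.val.map x),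
    Multiset.map_map]
  rfl

theorem logSpectrum_diagonal {n : Type} [Fintype n] [DecidableEq n] (x : n → ℝ) :
    logSpectrum (Matrix.diagonal fun i => (x i : ℂ)) =
      Finset.univ.val.map fun i => Real.log (x i) := by
  rw [logSpectrum, roots_charpoly_diagonal, Multiset.map_map]
  simp

theorem logSpectrum_fromBlocks {m n : Type} [Fintype n] [DecidableEq n] [Fintype m] [DecidableEq m]
    (M : Matrix m m ℂ) (N : Matrix n n ℂ) :
    logSpectrum (Matrix.fromBlocks M 0 0 N) = logSpectrum M + logSpectrum N := by
  rw [logSpectrum, Matrix.charpoly_fromBlocks_zero₁₂, Polynomial.roots_mul, Multiset.map_add]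
  · rfl
  · exact mul_ne_zero M.charpoly_monic.ne_zero N.charpoly_monic.ne_zero

theorem logSpectrum_mul_comm {n : Type} [Fintype n] [DecidableEq n] (M N : Matrix n n ℂ) :
    logSpectrum (M * N) = logSpectrum (N * M) := by
  rw [logSpectrum, Matrix.charpoly_mul_comm, logSpectrum]

theorem logSpectrum_reindex {m n : Type} [Fintype n] [DecidableEq n] [Fintype m] [DecidableEq m]
    (e : n ≃ m) (M : Matrix n n ℂ) : logSpectrum (Matrix.reindex e e M) = logSpectrum M := by
  rw [logSpectrum, Matrix.charpoly_reindex, logSpectrum]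

/-! ### Improvable pairs -/

/-- `Improvable A B`: some curve of unitary matrices through the identity strictly decreases
the logarithmic spectrum of `A⁻¹ * (γ * B * γᴴ)` with respect to majorization. -/
def Improvable {n : Type} [Fintype n] [DecidableEq n] (A B : Matrix n n ℂ) : Prop :=
  ∃ t₀ : ℝ, 0 < t₀ ∧ ∃ γ : ℝ → Matrix.unitaryGroup n ℂ,
    ContinuousOn γ (Set.Ioo (-t₀) t₀) ∧ γ 0 = 1 ∧
    ∀ t ∈ Set.Ioo (-t₀) t₀, t ≠ 0 → StrictlyMajorized
      (logSpectrum (A⁻¹ * ((γ t : Matrix n n ℂ) * B * (γ t : Matrix n n ℂ)ᴴ)))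
      (logSpectrum (A⁻¹ * B))

theorem inv_conj_of_mem_unitaryGroup {n : Type} [Fintype n] [DecidableEq n]
    {V : Matrix n n ℂ} (hV : V ∈ Matrix.unitaryGroup n ℂ) (A : Matrix n n ℂ) :
    (Vᴴ * A * V)⁻¹ = Vᴴ * A⁻¹ * V := by
  rw [Matrix.mul_inv_rev, Matrix.mul_inv_rev,
    Matrix.inv_eq_left_inv (show Vᴴ * V = 1 from Matrix.mem_unitaryGroup_iff'.1 hV),
    Matrix.inv_eq_left_inv (show V * Vᴴ = 1 from Matrix.mem_unitaryGroup_iff.1 hV), mul_assoc]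

theorem Improvable.conj {n : Type} [Fintype n] [DecidableEq n] {A B V : Matrix n n ℂ}
    (hV : V ∈ Matrix.unitaryGroup n ℂ) (h : Improvable (Vᴴ * A * V) (Vᴴ * B * V)) :
    Improvable A B := by
  obtain ⟨t₀, ht₀, γ, hγ, h0, h⟩ := h
  set v : Matrix.unitaryGroup n ℂ := ⟨V, hV⟩
  have h2 : V * Vᴴ = 1 := Matrix.mem_unitaryGroup_iff.1 hV
  refine ⟨t₀, ht₀, fun t => v * γ t * v⁻¹, ?_, by simp [h0], fun t ht htne => ?_⟩
  · exact (continuousOn_const.mul hγ).mul continuousOn_const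
  · have h := h t ht htne
    have key : ∀ X : Matrix n n ℂ, logSpectrum ((Vᴴ * A * V)⁻¹ * X)
        = logSpectrum (A⁻¹ * (V * X * Vᴴ)) := by
      intro X
      rw [inv_conj_of_mem_unitaryGroup hV, mul_assoc, mul_assoc, logSpectrum_mul_comm]
      simp only [mul_assoc]
    rw [key, key] at h
    have e1 : V * (Vᴴ * B * V) * Vᴴ = B := by
      calc _ = (V * Vᴴ) * B * (V * Vᴴ) := by noncomm_ring
        _ = B := by simp [h2]
    rw [e1] at h
    have e2 : ((v * γ t * v⁻¹ : Matrix.unitaryGroup n ℂ) : Matrix n n ℂ)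
        = V * (γ t : Matrix n n ℂ) * Vᴴ := rfl
    convert h using 3
    rw [e2]
    simp only [Matrix.conjTranspose_mul, Matrix.conjTranspose_conjTranspose, mul_assoc]

theorem Improvable.reindex {m n : Type} [Fintype n] [DecidableEq n] [Fintype m] [DecidableEq m]
    (e : m ≃ n) {A B : Matrix n n ℂ} (h : Improvable (A.submatrix e e) (B.submatrix e e)) :
    Improvable A B := by
  obtain ⟨t₀, ht₀, γ, hγ, h0, h⟩ := h
  have hu : ∀ U : Matrix.unitaryGroup m ℂ,
      (U : Matrix m m ℂ).submatrix e.symm e.symm ∈ Matrix.unitaryGroup n ℂ := by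
    intro U
    rw [Matrix.mem_unitaryGroup_iff, Matrix.star_eq_conjTranspose, Matrix.conjTranspose_submatrix,
      Matrix.submatrix_mul_equiv, ← Matrix.star_eq_conjTranspose,
      Matrix.mem_unitaryGroup_iff.1 U.2, Matrix.submatrix_one_equiv]
  refine ⟨t₀, ht₀, fun t => ⟨_, hu (γ t)⟩, ?_, ?_, fun t ht htne => ?_⟩
  · have : Continuous fun U : Matrix.unitaryGroup m ℂ => (⟨_, hu U⟩ : Matrix.unitaryGroup n ℂ) :=
      (continuous_subtype_val.matrix_submatrix _ _).subtype_mk _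
    exact this.comp_continuousOn hγ
  · exact Subtype.ext (by simp [h0])
  · have h := h t ht htne
    have key : ∀ X : Matrix m m ℂ, logSpectrum ((A.submatrix e e)⁻¹ * X)
        = logSpectrum (A⁻¹ * X.submatrix e.symm e.symm) := by
      intro X
      rw [← logSpectrum_reindex e, Matrix.reindex_apply, ← Matrix.submatrix_mul_equiv _ _ _ e.symm,
        Matrix.inv_submatrix_equiv]
      simp
    rw [key, key] at h
    convert h using 3
    · rw [← Matrix.submatrix_mul_equiv _ _ _ e.symm, ← Matrix.submatrix_mul_equiv _ _ _ e.symm]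
      simp [Matrix.conjTranspose_submatrix]
    · simp

/-- The curve is extended by the identity on the second block, whose spectrum is added unchanged to
both sides. -/
theorem Improvable.fromBlocks {m n : Type} [Fintype n] [DecidableEq n] [Fintype m] [DecidableEq m]
    {A B : Matrix m m ℂ} (h : Improvable A B) (hA : IsUnit A) {A' : Matrix n n ℂ}
    (hA' : IsUnit A') (B' : Matrix n n ℂ) :
    Improvable (Matrix.fromBlocks A 0 0 A') (Matrix.fromBlocks B 0 0 B') := by
  obtain ⟨t₀, ht₀, γ, hγ, h0, h⟩ := h
  have hu : ∀ U : Matrix.unitaryGroup m ℂ,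
      Matrix.fromBlocks (U : Matrix m m ℂ) 0 0 (1 : Matrix n n ℂ)
        ∈ Matrix.unitaryGroup (m ⊕ n) ℂ := by
    intro U
    rw [Matrix.mem_unitaryGroup_iff, Matrix.star_eq_conjTranspose, Matrix.fromBlocks_conjTranspose,
      Matrix.fromBlocks_multiply]
    have := Matrix.mem_unitaryGroup_iff.1 U.2
    rw [Matrix.star_eq_conjTranspose] at this
    simp [this]
  refine ⟨t₀, ht₀, fun t => ⟨_, hu (γ t)⟩, ?_, ?_, fun t ht htne => ?_⟩
  · have : Continuous fun U : Matrix.unitaryGroup m ℂ =>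
        (⟨_, hu U⟩ : Matrix.unitaryGroup (m ⊕ n) ℂ) :=
      (continuous_subtype_val.matrix_fromBlocks continuous_const continuous_const
        continuous_const).subtype_mk _
    exact this.comp_continuousOn hγ
  · exact Subtype.ext (by simp [h0])
  · have hinv : (Matrix.fromBlocks A 0 0 A')⁻¹ = Matrix.fromBlocks A⁻¹ 0 0 A'⁻¹ := by
      refine Matrix.inv_eq_left_inv ?_
      rw [Matrix.fromBlocks_multiply]
      simp [Matrix.nonsing_inv_mul _ ((Matrix.isUnit_iff_isUnit_det _).1 hA),
        Matrix.nonsing_inv_mul _ ((Matrix.isUnit_iff_isUnit_det _).1 hA')]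
    have := (h t ht htne).add_right (logSpectrum (A'⁻¹ * B'))
    rw [← logSpectrum_fromBlocks, ← logSpectrum_fromBlocks] at this
    convert this using 2
    · rw [hinv, Matrix.fromBlocks_conjTranspose]
      simp [Matrix.fromBlocks_multiply]
    · rw [hinv]; simp [Matrix.fromBlocks_multiply]

/-! ### Trace duality -/

theorem eq_zero_of_re_trace_conjTranspose_mul_self {n : Type} [Fintype n] {G : Matrix n n ℂ}
    (h : (Gᴴ * G).trace.re = 0) : G = 0 := by
  rw [← Matrix.trace_conjTranspose_mul_self_eq_zero_iff]
  have h0 : 0 ≤ (Gᴴ * G).trace := (Matrix.posSemidef_conjTranspose_mul_self G).trace_nonneg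
  exact Complex.ext h (Complex.nonneg_iff.1 h0).2.symm

theorem re_trace_conjTranspose {n : Type} [Fintype n] (M : Matrix n n ℂ) :
    Mᴴ.trace.re = M.trace.re := by
  simp [Matrix.trace_conjTranspose]

theorem eq_zero_of_re_trace_mul_sub {n : Type} [Fintype n] {G : Matrix n n ℂ} (hG : Gᴴ = -G)
    (h : ∀ Z : Matrix n n ℂ, (G * (Z - Zᴴ)).trace.re = 0) : G = 0 := by
  refine eq_zero_of_re_trace_conjTranspose_mul_self ?_
  have := h G
  simp only [hG, sub_neg_eq_add, mul_add, Matrix.trace_add, Complex.add_re] at this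
  simp only [hG, neg_mul, Matrix.trace_neg, Complex.neg_re]
  linarith

theorem isHermitian_of_re_trace_mul_sub {n : Type} [Fintype n] {T : Matrix n n ℂ}
    (h : ∀ K : Matrix n n ℂ, (T * (K - Kᴴ)).trace.re = 0) : Tᴴ = T := by
  have hskew : (T - Tᴴ)ᴴ = -(T - Tᴴ) := by simp
  refine (sub_eq_zero.1 (eq_zero_of_re_trace_mul_sub hskew fun Z => ?_)).symm
  have h1 : (Tᴴ * (Z - Zᴴ)).trace.re = -(T * (Z - Zᴴ)).trace.re := by
    rw [← re_trace_conjTranspose, Matrix.conjTranspose_mul, Matrix.trace_mul_comm]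
    simp [mul_sub]
  rw [sub_mul, Matrix.trace_sub, Complex.sub_re, h1, h Z]
  simp

/-- By cyclicity the hypothesis pairs `Λ * T - T * Λ` with all skew-Hermitian matrices, and this
commutator is itself skew-Hermitian. -/
theorem mul_comm_of_re_trace_commutator {n : Type} [Fintype n] {T Λ : Matrix n n ℂ}
    (hT : Tᴴ = T) (hΛ : Λᴴ = Λ)
    (h : ∀ Z : Matrix n n ℂ, (T * ((Z - Zᴴ) * Λ - Λ * (Z - Zᴴ))).trace.re = 0) :
    Λ * T = T * Λ := by
  refine sub_eq_zero.1 (eq_zero_of_re_trace_mul_sub ?_ fun Z => ?_)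
  · simp [Matrix.conjTranspose_mul, hT, hΛ]
  · rw [← h Z, sub_mul, mul_sub T, Matrix.trace_sub, Matrix.trace_sub, mul_assoc Λ,
      Matrix.trace_mul_comm Λ]
    simp only [mul_assoc]

theorem exists_eq_re_trace_mul {n : Type} [Fintype n] [DecidableEq n]
    (f : Module.Dual ℝ (Matrix n n ℂ)) :
    ∃ T : Matrix n n ℂ, ∀ M, f M = (T * M).trace.re := by
  let Φ : Matrix n n ℂ →ₗ[ℝ] Module.Dual ℝ (Matrix n n ℂ) :=
    LinearMap.mk₂ ℝ (fun T M => (T * M).trace.re) (by simp [add_mul]) (by simp) (by simp [mul_add])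
      (by simp)
  have hinj : Function.Injective Φ := by
    rw [injective_iff_map_eq_zero]
    intro T hT
    have h1 : (T * Tᴴ).trace.re = 0 := LinearMap.congr_fun hT Tᴴ
    have := eq_zero_of_re_trace_conjTranspose_mul_self (G := Tᴴ) (by simpa using h1)
    simpa using this
  obtain ⟨T, hT⟩ := (LinearMap.injective_iff_surjective_of_finrank_eq_finrank
    (Subspace.dual_finrank_eq).symm).1 hinj f
  exact ⟨T, fun M => by rw [← hT]; rfl⟩

/-- A proper subspace lies in the kernel of a nonzero functional, and every real functional has the
form `M ↦ Re tr (T * M)`. -/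
theorem surjective_of_re_trace_mul {n : Type} [Fintype n] [DecidableEq n] {E : Type*}
    [AddCommGroup E] [Module ℝ E] (L : E →ₗ[ℝ] Matrix n n ℂ)
    (h : ∀ T : Matrix n n ℂ, (∀ x, (T * L x).trace.re = 0) → T = 0) : Function.Surjective L := by
  rw [← LinearMap.range_eq_top]
  by_contra hne
  obtain ⟨f, hf, hle⟩ := Submodule.exists_le_ker_of_lt_top _ (lt_top_iff_ne_top.2 hne)
  obtain ⟨T, hT⟩ := exists_eq_re_trace_mul f
  refine hf (LinearMap.ext fun M => ?_)
  have : T = 0 := h T fun x => by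
    rw [← hT]
    exact hle ⟨x, rfl⟩
  simp [hT, this]

/-! ### Simultaneous reduction of two positive definite matrices -/

theorem Matrix.IsHermitian.exists_diagonalization {n : Type} [Fintype n] [DecidableEq n]
    {N : Matrix n n ℂ} (hN : N.IsHermitian) :
    ∃ V ∈ Matrix.unitaryGroup n ℂ, ∃ ν : n → ℝ,
      Vᴴ * N * V = Matrix.diagonal fun i => (ν i : ℂ) := by
  refine ⟨hN.eigenvectorUnitary, hN.eigenvectorUnitary.2, hN.eigenvalues, ?_⟩
  have h := hN.conjStarAlgAut_star_eigenvectorUnitary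
  rw [Unitary.conjStarAlgAut_apply] at h
  simpa [Matrix.star_eq_conjTranspose, Function.comp_def] using h

theorem Matrix.PosDef.conj_of_isUnit {n : Type} [Fintype n] [DecidableEq n]
    {B W : Matrix n n ℂ} (hB : B.PosDef) (hW : IsUnit W) : (Wᴴ * B * W).PosDef :=
  hB.conjTranspose_mul_mul_same (Matrix.mulVec_injective_of_isUnit hW)

theorem isUnit_of_mem_unitaryGroup {n : Type} [Fintype n] [DecidableEq n]
    {V : Matrix n n ℂ} (hV : V ∈ Matrix.unitaryGroup n ℂ) : IsUnit V :=
  IsUnit.of_mul_eq_one _ (Matrix.mem_unitaryGroup_iff.1 hV)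

theorem posDef_diagonal_ofReal_iff {n : Type} [Fintype n] [DecidableEq n] {x : n → ℝ} :
    (Matrix.diagonal fun i => (x i : ℂ)).PosDef ↔ ∀ i, 0 < x i := by
  simp [Matrix.posDef_diagonal_iff]

theorem Matrix.PosDef.exists_mul_conjTranspose_self {n : Type} [Fintype n] [DecidableEq n]
    {A : Matrix n n ℂ} (hA : A.PosDef) : ∃ Y : Matrix n n ℂ, Y * Yᴴ = A := by
  obtain ⟨V, hV, a, ha⟩ := hA.isHermitian.exists_diagonalization
  have hpos : ∀ i, 0 < a i := by
    rw [← posDef_diagonal_ofReal_iff, ← ha]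
    exact hA.conj_of_isUnit (isUnit_of_mem_unitaryGroup hV)
  have h2 : V * Vᴴ = 1 := Matrix.mem_unitaryGroup_iff.1 hV
  refine ⟨V * Matrix.diagonal fun i => (Real.sqrt (a i) : ℂ), ?_⟩
  have h3 : (Matrix.diagonal fun i => (Real.sqrt (a i) : ℂ)) *
      (Matrix.diagonal fun i => (Real.sqrt (a i) : ℂ))ᴴ = Vᴴ * A * V := by
    rw [ha, Matrix.diagonal_conjTranspose, Matrix.diagonal_mul_diagonal]
    congr 1
    funext i
    rw [Pi.star_apply, Complex.star_def, Complex.conj_ofReal, ← Complex.ofReal_mul,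
      Real.mul_self_sqrt (hpos i).le]
  rw [Matrix.conjTranspose_mul, mul_assoc, ← mul_assoc _ _ Vᴴ, h3]
  calc V * (Vᴴ * A * V * Vᴴ) = (V * Vᴴ) * A * (V * Vᴴ) := by simp only [mul_assoc]
    _ = A := by simp [h2]

/-- The factor `W` replaces the non-Hermitian `A⁻¹ * B` by the Hermitian `Wᴴ * B * W`, which has the
same characteristic polynomial. -/
theorem exists_simultaneous_congruence {n : Type} [Fintype n] [DecidableEq n]
    {A B : Matrix n n ℂ} (hA : A.PosDef) (hB : B.PosDef) :
    ∃ W : Matrix n n ℂ, ∃ μ : n → ℝ, W * Wᴴ = A⁻¹ ∧ (∀ i, 0 < μ i) ∧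
      Wᴴ * B * W = Matrix.diagonal fun i => (μ i : ℂ) := by
  obtain ⟨Y, hY⟩ := hA.inv.exists_mul_conjTranspose_self
  have hYu : IsUnit Y := by
    have h : IsUnit (Y * Yᴴ) := hY ▸ hA.inv.isUnit
    rw [Matrix.isUnit_iff_isUnit_det, Matrix.det_mul] at h
    exact (Matrix.isUnit_iff_isUnit_det _).2 (isUnit_of_mul_isUnit_left h)
  have hYB := hB.conj_of_isUnit hYu
  obtain ⟨V, hV, μ, hμ⟩ := hYB.isHermitian.exists_diagonalization
  refine ⟨Y * V, μ, ?_, ?_, ?_⟩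
  · rw [Matrix.conjTranspose_mul, mul_assoc, ← mul_assoc V,
      show V * Vᴴ = 1 from Matrix.mem_unitaryGroup_iff.1 hV, one_mul, hY]
  · rw [← posDef_diagonal_ofReal_iff, ← hμ]
    exact hYB.conj_of_isUnit (isUnit_of_mem_unitaryGroup hV)
  · rw [← hμ, Matrix.conjTranspose_mul]
    simp only [mul_assoc]

/-! ### Surjectivity of the linearized orbit map -/

/-- Orthogonality to each family of directions restricts `T`: `K` makes it Hermitian, `Z` makes it
commute with `Λ`, and `X` makes `S = W * T * Wᴴ` commute with `B`. Then `S * B` is Hermitian and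
commutes with `A` and `B`, so it is scalar; the direction `r` forces this scalar to vanish. -/
theorem eq_zero_of_orthogonal_orbit {n : Type} [Fintype n] [DecidableEq n] [Nonempty n]
    {A B W Λ : Matrix n n ℂ} (hA : IsUnit A) (hB : B.PosDef) (hW : W * Wᴴ = A⁻¹)
    (hΛ : Wᴴ * B * W = Λ)
    (hirr : ∀ N : Matrix n n ℂ, N.IsHermitian → N * A = A * N → N * B = B * N →
      ∃ c : ℂ, N = c • (1 : Matrix n n ℂ))
    {T : Matrix n n ℂ} (hK : ∀ K : Matrix n n ℂ, (T * (K - Kᴴ)).trace.re = 0)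
    (hZ : ∀ Z : Matrix n n ℂ, (T * ((Z - Zᴴ) * Λ - Λ * (Z - Zᴴ))).trace.re = 0)
    (hX : ∀ X : Matrix n n ℂ, (T * (Wᴴ * ((X - Xᴴ) * B - B * (X - Xᴴ)) * W)).trace.re = 0)
    (hr : (T * Λ).trace.re = 0) : T = 0 := by
  have hT : Tᴴ = T := isHermitian_of_re_trace_mul_sub hK
  have hBH : Bᴴ = B := hB.isHermitian
  have hΛH : Λᴴ = Λ := by
    rw [← hΛ]; simp [Matrix.conjTranspose_mul, hBH, mul_assoc]
  have hAA : A⁻¹ * A = 1 := Matrix.nonsing_inv_mul _ ((Matrix.isUnit_iff_isUnit_det _).1 hA)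
  have hAA' : A * A⁻¹ = 1 := Matrix.mul_nonsing_inv _ ((Matrix.isUnit_iff_isUnit_det _).1 hA)
  have h1 : Wᴴ * (A * W) = 1 := by
    have : W * (Wᴴ * A) = 1 := by rw [← mul_assoc, hW, hAA]
    rw [← mul_assoc]
    exact mul_eq_one_comm.1 this
  have hTΛ : Λ * T = T * Λ := mul_comm_of_re_trace_commutator hT hΛH hZ
  set S := W * T * Wᴴ with hS
  have hSH : Sᴴ = S := by simp [hS, Matrix.conjTranspose_mul, hT, mul_assoc]
  have hSB : B * S = S * B := by
    refine mul_comm_of_re_trace_commutator hSH hBH fun X => ?_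
    rw [← hX X, ← mul_assoc T, Matrix.trace_mul_comm _ W]
    simp only [hS, mul_assoc]
  -- Both sides equal `W * (Λ * T) * Wᴴ`, up to exchanging `Λ` and `T`.
  have hN : A⁻¹ * (B * S) = S * B * A⁻¹ := by
    rw [← hW]
    calc W * Wᴴ * (B * S) = W * (Wᴴ * B * W * T) * Wᴴ := by simp only [hS, mul_assoc]
      _ = W * (T * (Wᴴ * B * W)) * Wᴴ := by rw [hΛ, hTΛ]
      _ = S * B * (W * Wᴴ) := by simp only [hS, mul_assoc]
  have hNA : S * B * A = A * (S * B) := by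
    calc S * B * A = A * (A⁻¹ * (B * S)) * A := by rw [← mul_assoc A, hAA', one_mul, hSB]
      _ = A * (S * B) * (A⁻¹ * A) := by rw [hN]; simp only [mul_assoc]
      _ = A * (S * B) := by rw [hAA, mul_one]
  obtain ⟨c, hc⟩ := hirr (S * B) (by
    rw [Matrix.IsHermitian, Matrix.conjTranspose_mul, hSH, hBH, hSB]) hNA (by
    rw [← mul_assoc, hSB])
  have hTΛc : T * Λ = c • (1 : Matrix n n ℂ) := by
    calc T * Λ = Wᴴ * (A * W) * T * (Wᴴ * B * W) := by rw [h1, one_mul, hΛ]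
      _ = Wᴴ * A * (S * B) * W := by simp only [hS, mul_assoc]
      _ = c • (1 : Matrix n n ℂ) := by rw [hc]; simp [mul_assoc, h1]
  have hcre : c.re = 0 := by
    rw [hTΛc] at hr
    simpa using hr
  have hcim : c.im = 0 := by
    have h : (T * Λ)ᴴ = T * Λ := by rw [Matrix.conjTranspose_mul, hT, hΛH, hTΛ]
    rw [hTΛc] at h
    have := congrFun (congrFun h (Classical.arbitrary n)) (Classical.arbitrary n)
    simpa [Complex.conj_eq_iff_im] using this
  have hc0 : c = 0 := Complex.ext hcre hcim
  rw [hc0, zero_smul] at hc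
  have hS0 : S = 0 := by
    have := congrArg (· * B⁻¹) hc
    simpa [mul_assoc, Matrix.mul_nonsing_inv _ ((Matrix.isUnit_iff_isUnit_det _).1 hB.isUnit)]
      using this
  calc T = (Wᴴ * (A * W)) * T * (Wᴴ * (A * W)) := by rw [h1]; simp
    _ = Wᴴ * A * S * (A * W) := by simp only [hS, mul_assoc]
    _ = 0 := by simp [hS0]

/-! ### Solving for the spectrum by the inverse function theorem -/

theorem exp_sub_conjTranspose_mem_unitaryGroup {n : Type} [Fintype n] [DecidableEq n]
    (X : Matrix n n ℂ) : NormedSpace.exp (X - Xᴴ) ∈ Matrix.unitaryGroup n ℂ := by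
  rw [Matrix.mem_unitaryGroup_iff, Matrix.star_eq_conjTranspose, ← Matrix.exp_conjTranspose,
    Matrix.conjTranspose_sub, Matrix.conjTranspose_conjTranspose, ← neg_sub X, Matrix.exp_neg]
  exact Matrix.mul_nonsing_inv _ ((Matrix.isUnit_iff_isUnit_det _).1 (Matrix.isUnit_exp _))

theorem exp_neg_sub_conjTranspose {n : Type} [Fintype n] [DecidableEq n]
    (X : Matrix n n ℂ) : NormedSpace.exp (-(X - Xᴴ)) = (NormedSpace.exp (X - Xᴴ))ᴴ := by
  rw [← Matrix.exp_conjTranspose]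
  simp

/-- The unitary matrix `exp (X - Xᴴ)`. -/
noncomputable def expUnitaryGroup {n : Type} [Fintype n] [DecidableEq n] (X : Matrix n n ℂ) :
    Matrix.unitaryGroup n ℂ :=
  ⟨_, exp_sub_conjTranspose_mem_unitaryGroup X⟩

/-- A scaled congruence orbit through `Wᴴ * B * W`, with an additional skew-Hermitian summand. -/
noncomputable def orbitMap {n : Type} [Fintype n] [DecidableEq n] (B W : Matrix n n ℂ)
    (p : Matrix n n ℂ × Matrix n n ℂ × Matrix n n ℂ × ℝ) : Matrix n n ℂ :=
  Real.exp p.2.2.2 • (NormedSpace.exp (p.2.1 - p.2.1ᴴ) * (Wᴴ * (NormedSpace.exp (p.1 - p.1ᴴ) * B *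
    NormedSpace.exp (-(p.1 - p.1ᴴ))) * W) * NormedSpace.exp (-(p.2.1 - p.2.1ᴴ)))
    + (p.2.2.1 - p.2.2.1ᴴ)

section
open scoped Matrix.Norms.L2Operator

/-- The map `X ↦ X - Xᴴ` as a continuous real-linear map. -/
noncomputable def skewCLM (n : Type) [Fintype n] [DecidableEq n] :
    Matrix n n ℂ →L[ℝ] Matrix n n ℂ :=
  LinearMap.toContinuousLinearMap
    { toFun := fun X => X - Xᴴ
      map_add' := fun X Y => by simp; abel
      map_smul' := fun r X => by simp [smul_sub] }

theorem skewCLM_apply {n : Type} [Fintype n] [DecidableEq n] (X : Matrix n n ℂ) :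
    skewCLM n X = X - Xᴴ := rfl

theorem hasStrictFDerivAt_exp_comp {n : Type} [Fintype n] [DecidableEq n] {E : Type*}
    [NormedAddCommGroup E] [NormedSpace ℝ E] (L : E →L[ℝ] Matrix n n ℂ) :
    HasStrictFDerivAt (fun x => NormedSpace.exp (L x)) L 0 := by
  have h : HasStrictFDerivAt (NormedSpace.exp : Matrix n n ℂ → Matrix n n ℂ)
      (1 : Matrix n n ℂ →L[ℝ] Matrix n n ℂ) (L 0) := by
    rw [map_zero]; exact hasStrictFDerivAt_exp_zero
  exact h.comp 0 L.hasStrictFDerivAt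

theorem exists_hasStrictFDerivAt_orbitMap {n : Type} [Fintype n] [DecidableEq n]
    (B W : Matrix n n ℂ) :
    ∃ L : (Matrix n n ℂ × Matrix n n ℂ × Matrix n n ℂ × ℝ) →L[ℝ] Matrix n n ℂ,
      HasStrictFDerivAt (orbitMap B W) L 0 ∧ ∀ X Z K : Matrix n n ℂ, ∀ r : ℝ,
        L (X, Z, K, r) = r • (Wᴴ * B * W) +
          ((Z - Zᴴ) * (Wᴴ * B * W) - (Wᴴ * B * W) * (Z - Zᴴ)) +
          Wᴴ * ((X - Xᴴ) * B - B * (X - Xᴴ)) * W + (K - Kᴴ) := by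
  let M := Matrix n n ℂ
  let pX : (M × M × M × ℝ) →L[ℝ] M := (skewCLM n).comp (ContinuousLinearMap.fst ℝ M (M × M × ℝ))
  let q1 : (M × M × M × ℝ) →L[ℝ] (M × M × ℝ) := ContinuousLinearMap.snd ℝ M (M × M × ℝ)
  let pZ : (M × M × M × ℝ) →L[ℝ] M :=
    (skewCLM n).comp ((ContinuousLinearMap.fst ℝ M (M × ℝ)).comp q1)
  let q2 : (M × M × M × ℝ) →L[ℝ] (M × ℝ) := (ContinuousLinearMap.snd ℝ M (M × ℝ)).comp q1
  let pK : (M × M × M × ℝ) →L[ℝ] M := (skewCLM n).comp ((ContinuousLinearMap.fst ℝ M ℝ).comp q2)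
  let pr : (M × M × M × ℝ) →L[ℝ] ℝ := (ContinuousLinearMap.snd ℝ M ℝ).comp q2
  have hr : HasStrictFDerivAt (fun p => Real.exp (pr p)) (Real.exp (pr 0) • pr) 0 :=
    pr.hasStrictFDerivAt.exp
  have hX := hasStrictFDerivAt_exp_comp pX
  have hX' := hasStrictFDerivAt_exp_comp (-pX)
  have hZ := hasStrictFDerivAt_exp_comp pZ
  have hZ' := hasStrictFDerivAt_exp_comp (-pZ)
  have h1 := (((hX.mul_const' B).mul' hX').const_mul Wᴴ).mul_const' W
  have h2 := hr.smul ((hZ.mul' h1).mul' hZ')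
  have h3 := h2.add pK.hasStrictFDerivAt
  refine ⟨_, h3, fun X Z K r => ?_⟩
  simp [pX, pZ, pK, pr, q1, q2, skewCLM_apply]
  noncomm_ring

/-- On the range of a linear right inverse of `L`, the map has derivative the identity, so the
ordinary inverse function theorem applies. -/
theorem exists_local_inverse_of_surjective {E F : Type*} [NormedAddCommGroup E] [NormedSpace ℝ E]
    [NormedAddCommGroup F] [NormedSpace ℝ F] [FiniteDimensional ℝ F] {f : E → F} {L : E →L[ℝ] F}
    (hf : HasStrictFDerivAt f L 0) (hL : Function.Surjective L) :
    ∃ U : Set F, IsOpen U ∧ f 0 ∈ U ∧ ∃ g : F → E, ContinuousOn g U ∧ g (f 0) = 0 ∧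
      ∀ y ∈ U, f (g y) = y := by
  obtain ⟨R, hR⟩ := LinearMap.exists_rightInverse_of_surjective (L : E →ₗ[ℝ] F)
    (LinearMap.range_eq_top.2 hL)
  let R' : F →L[ℝ] E := LinearMap.toContinuousLinearMap R
  have hcomp : L.comp R' = ((ContinuousLinearEquiv.refl ℝ F : F ≃L[ℝ] F) : F →L[ℝ] F) := by
    ext y
    exact LinearMap.congr_fun hR y
  have h : HasStrictFDerivAt (fun y => f (R' y))
      ((ContinuousLinearEquiv.refl ℝ F : F ≃L[ℝ] F) : F →L[ℝ] F) 0 := by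
    rw [← hcomp]
    refine HasStrictFDerivAt.comp (0 : F) (g := f) ?_ R'.hasStrictFDerivAt
    rwa [map_zero]
  have : CompleteSpace F := FiniteDimensional.complete ℝ F
  let φ := h.toOpenPartialHomeomorph _
  have h0 : (0 : F) ∈ φ.source := h.mem_toOpenPartialHomeomorph_source
  have hφ0 : φ 0 = f 0 := by
    change f (R' 0) = f 0
    rw [map_zero]
  refine ⟨φ.target, φ.open_target, hφ0 ▸ φ.map_source h0, fun y => R' (φ.symm y),
    R'.continuous.comp_continuousOn φ.continuousOn_symm, ?_, fun y hy => φ.right_inv hy⟩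
  change R' (φ.symm (f 0)) = 0
  rw [← hφ0, φ.left_inv h0, map_zero]

theorem exists_orbitMap_section {n : Type} [Fintype n] [DecidableEq n] [Nonempty n]
    {A B W : Matrix n n ℂ} (hA : IsUnit A) (hB : B.PosDef) (hW : W * Wᴴ = A⁻¹)
    (hirr : ∀ N : Matrix n n ℂ, N.IsHermitian → N * A = A * N → N * B = B * N →
      ∃ c : ℂ, N = c • (1 : Matrix n n ℂ)) :
    ∃ U : Set (Matrix n n ℂ), IsOpen U ∧ Wᴴ * B * W ∈ U ∧
      ∃ g : Matrix n n ℂ → Matrix n n ℂ × Matrix n n ℂ × Matrix n n ℂ × ℝ,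
        ContinuousOn g U ∧ g (Wᴴ * B * W) = 0 ∧ ∀ y ∈ U, orbitMap B W (g y) = y := by
  have h0 : orbitMap B W 0 = Wᴴ * B * W := by simp [orbitMap]
  obtain ⟨L, hL, hLa⟩ := exists_hasStrictFDerivAt_orbitMap B W
  rw [← h0]
  refine exists_local_inverse_of_surjective hL
    (surjective_of_re_trace_mul L.toLinearMap fun T hT => ?_)
  have hT' : ∀ X Z K : Matrix n n ℂ, ∀ r : ℝ, (T * L (X, Z, K, r)).trace.re = 0 :=
    fun X Z K r => hT (X, Z, K, r)
  simp only [hLa] at hT'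
  refine eq_zero_of_orthogonal_orbit hA hB hW rfl hirr (fun K => ?_) (fun Z => ?_) (fun X => ?_) ?_
  · simpa using hT' 0 0 K 0
  · simpa using hT' 0 Z 0 0
  · simpa using hT' X 0 0 0
  · simpa using hT' 0 0 0 1

end

theorem skew_eq_zero_of_orbitMap_isHermitian {n : Type} [Fintype n] [DecidableEq n]
    {B W : Matrix n n ℂ} (hB : B.IsHermitian)
    {p : Matrix n n ℂ × Matrix n n ℂ × Matrix n n ℂ × ℝ} (hp : (orbitMap B W p).IsHermitian) :
    p.2.2.1 - p.2.2.1ᴴ = 0 := by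
  obtain ⟨X, Z, K, r⟩ := p
  have hBH : Bᴴ = B := hB
  rw [orbitMap, exp_neg_sub_conjTranspose, exp_neg_sub_conjTranspose, Matrix.IsHermitian] at hp
  simp only [Matrix.conjTranspose_add, Matrix.conjTranspose_smul, Matrix.conjTranspose_mul,
    Matrix.conjTranspose_sub, Matrix.conjTranspose_conjTranspose, hBH, star_trivial,
    mul_assoc] at hp
  have h := add_left_cancel hp
  have h2 : (2 : ℂ) • (K - Kᴴ) = 0 := by
    rw [two_smul]
    nth_rewrite 1 [← h]
    abel
  exact (smul_eq_zero.1 h2).resolve_left two_ne_zero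

/-- The auxiliary parameters leave no trace in the spectrum: Hermiticity kills the skew summand, the
determinant forces the scale to be `1`, and `Z` only conjugates by a unitary. -/
theorem logSpectrum_eq_of_orbitMap_eq {n : Type} [Fintype n] [DecidableEq n] [Nonempty n]
    {A B W : Matrix n n ℂ} (hB : B.IsHermitian) (hW : W * Wᴴ = A⁻¹)
    {p : Matrix n n ℂ × Matrix n n ℂ × Matrix n n ℂ × ℝ} (hp : (orbitMap B W p).IsHermitian)
    (hdet : (orbitMap B W p).det = (Wᴴ * B * W).det) (hdet0 : (Wᴴ * B * W).det ≠ 0) :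
    logSpectrum (A⁻¹ * ((expUnitaryGroup p.1 : Matrix n n ℂ) * B *
      (expUnitaryGroup p.1 : Matrix n n ℂ)ᴴ)) = logSpectrum (orbitMap B W p) := by
  have hK := skew_eq_zero_of_orbitMap_isHermitian hB hp
  obtain ⟨X, Z, K, r⟩ := p
  have hu : ∀ Y : Matrix n n ℂ, (NormedSpace.exp (Y - Yᴴ))ᴴ * NormedSpace.exp (Y - Yᴴ) = 1 :=
    fun Y => Matrix.mem_unitaryGroup_iff'.1 (exp_sub_conjTranspose_mem_unitaryGroup Y)
  have hud : ∀ Y : Matrix n n ℂ,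
      (NormedSpace.exp (Y - Yᴴ))ᴴ.det * (NormedSpace.exp (Y - Yᴴ)).det = 1 := fun Y => by
    rw [← Matrix.det_mul, hu, Matrix.det_one]
  have hF : orbitMap B W (X, Z, K, r) = Real.exp r • (NormedSpace.exp (Z - Zᴴ) *
      (Wᴴ * (NormedSpace.exp (X - Xᴴ) * B * (NormedSpace.exp (X - Xᴴ))ᴴ) * W) *
      (NormedSpace.exp (Z - Zᴴ))ᴴ) := by
    rw [orbitMap, hK, exp_neg_sub_conjTranspose, exp_neg_sub_conjTranspose, add_zero]
  have hr : Real.exp r = 1 := by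
    rw [hF, ← Complex.coe_smul, Matrix.det_smul] at hdet
    simp only [Matrix.det_mul] at hdet hdet0
    have h1 : ((Real.exp r : ℝ) : ℂ) ^ Fintype.card n = 1 := by
      refine mul_right_cancel₀ hdet0 ?_
      rw [one_mul]
      refine Eq.trans ?_ hdet
      linear_combination (-(Real.exp r : ℂ) ^ Fintype.card n * Wᴴ.det * B.det * W.det) *
        ((NormedSpace.exp (X - Xᴴ))ᴴ.det * (NormedSpace.exp (X - Xᴴ)).det * hud Z + hud X)
    have h2 : Real.exp r ^ Fintype.card n = 1 := by exact_mod_cast h1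
    exact (pow_eq_one_iff_of_nonneg (Real.exp_pos r).le Fintype.card_ne_zero).1 h2
  set Y : Matrix n n ℂ := NormedSpace.exp (X - Xᴴ) * B * (NormedSpace.exp (X - Xᴴ))ᴴ with hY
  calc logSpectrum (A⁻¹ * Y) = logSpectrum (W * (Wᴴ * Y)) := by rw [← mul_assoc W, hW]
    _ = logSpectrum ((NormedSpace.exp (Z - Zᴴ))ᴴ * NormedSpace.exp (Z - Zᴴ) * (Wᴴ * Y * W)) := by
      rw [logSpectrum_mul_comm, hu, one_mul]
    _ = logSpectrum (orbitMap B W (X, Z, K, r)) := by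
      rw [mul_assoc, logSpectrum_mul_comm, hF, hr, one_smul]

theorem continuous_expUnitaryGroup {n : Type} [Fintype n] [DecidableEq n] :
    Continuous (expUnitaryGroup : Matrix n n ℂ → Matrix.unitaryGroup n ℂ) := by
  open scoped Matrix.Norms.L2Operator in
  let : NormedAlgebra ℚ (Matrix n n ℂ) := NormedAlgebra.restrictScalars ℚ ℝ _
  open scoped Matrix.Norms.L2Operator in
  have h : Continuous fun X : Matrix n n ℂ => NormedSpace.exp (X - Xᴴ) :=
    (NormedSpace.exp_continuous (𝔸 := Matrix n n ℂ)).comp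
      (continuous_id.sub continuous_id.matrix_conjTranspose)
  exact h.subtype_mk _

theorem improvable_of_irreducible {n : Type} [Fintype n] [DecidableEq n] [Nonempty n]
    {A B : Matrix n n ℂ} (hA : A.PosDef) (hB : B.PosDef) (hAB : A * B ≠ B * A)
    (hirr : ∀ N : Matrix n n ℂ, N.IsHermitian → N * A = A * N → N * B = B * N →
      ∃ c : ℂ, N = c • (1 : Matrix n n ℂ)) : Improvable A B := by
  obtain ⟨W, μ, hW, hμ, hΛ⟩ := exists_simultaneous_congruence hA hB
  obtain ⟨U, hU, hΛU, g, hg, hg0, hFg⟩ := exists_orbitMap_section hA.isUnit hB hW hirr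
  set x : n → ℝ := fun i => Real.log (μ i) with hx
  set c : ℝ := (∑ i, x i) / Fintype.card n with hc
  have hcsum : Fintype.card n * c = ∑ i, x i := by rw [hc]; field_simp
  have hxc : ∃ i, x i ≠ c := by
    by_contra! hall
    have hμc : ∀ i, μ i = Real.exp c := fun i => by rw [← hall i, hx, Real.exp_log (hμ i)]
    have hAA : A⁻¹ * A = 1 :=
      Matrix.nonsing_inv_mul _ ((Matrix.isUnit_iff_isUnit_det _).1 hA.isUnit)
    have h1 : W * (Wᴴ * A) = 1 := by rw [← mul_assoc, hW, hAA]
    have h2 : A * W * Wᴴ = 1 := by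
      rw [mul_assoc, hW, Matrix.mul_nonsing_inv _ ((Matrix.isUnit_iff_isUnit_det _).1 hA.isUnit)]
    have h3 : Wᴴ * B * W = (Real.exp c : ℂ) • (1 : Matrix n n ℂ) := by
      rw [hΛ, Matrix.smul_one_eq_diagonal]
      simp only [hμc]
    have h4 : B = (Real.exp c : ℂ) • A := by
      calc B = (A * W * Wᴴ) * B * (W * (Wᴴ * A)) := by rw [h1, h2]; simp
        _ = A * W * (Wᴴ * B * W) * (Wᴴ * A) := by simp only [mul_assoc]
        _ = (Real.exp c : ℂ) • (A * (W * (Wᴴ * A))) := by rw [h3]; simp [mul_assoc]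
        _ = _ := by rw [h1, mul_one]
    exact hAB (by rw [h4]; simp)
  -- The absolute value makes the contraction happen on both sides of `0`; keeping the mean keeps
  -- the determinant.
  let y : ℝ → n → ℝ := fun t i => (1 - |t|) * x i + |t| * c
  let Γ : ℝ → Matrix n n ℂ := fun t => Matrix.diagonal fun i => (Real.exp (y t i) : ℂ)
  have hΓ : Continuous Γ := by
    refine Continuous.matrix_diagonal (continuous_pi fun i => ?_)
    fun_prop
  have hΓ0 : Γ 0 = Wᴴ * B * W := by
    rw [hΛ]
    simp only [Γ, y, hx, abs_zero, sub_zero, one_mul, zero_mul, add_zero, Real.exp_log (hμ _)]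
  have hspec : ∀ t, logSpectrum (Γ t) = Finset.univ.val.map (y t) := fun t => by
    rw [logSpectrum_diagonal]; simp
  have hdet : ∀ t, (Γ t).det = (Wᴴ * B * W).det := fun t => by
    rw [← hΓ0]
    simp only [Γ, Matrix.det_diagonal]
    rw [← Complex.ofReal_prod, ← Complex.ofReal_prod, ← Real.exp_sum, ← Real.exp_sum]
    congr 2
    simp only [y, Finset.sum_add_distrib, ← Finset.mul_sum, ← hcsum]
    simp; ring
  have hnear : ∀ᶠ t in nhds (0 : ℝ), Γ t ∈ U :=
    hΓ.continuousAt.eventually_mem (hU.mem_nhds (hΓ0 ▸ hΛU))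
  obtain ⟨ε, hε, hball⟩ := Metric.eventually_nhds_iff.1 hnear
  have hmem : ∀ t ∈ Set.Ioo (-min ε 1) (min ε 1), Γ t ∈ U ∧ |t| < 1 := fun t ht => by
    have h := abs_lt.2 ht
    exact ⟨hball (by simpa using h.trans_le (min_le_left _ _)), h.trans_le (min_le_right _ _)⟩
  refine ⟨min ε 1, lt_min hε one_pos, fun t => expUnitaryGroup (g (Γ t)).1, ?_, ?_, ?_⟩
  · have h1 : ContinuousOn (fun t => (g (Γ t)).1) (Set.Ioo (-min ε 1) (min ε 1)) :=
      continuous_fst.comp_continuousOn (hg.comp hΓ.continuousOn fun t ht => (hmem t ht).1)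
    exact continuous_expUnitaryGroup.comp_continuousOn h1
  · simp only [hΓ0, hg0]
    exact Subtype.ext (by simp [expUnitaryGroup])
  · intro t ht ht0
    have hF := hFg _ (hmem t ht).1
    have hlog := logSpectrum_eq_of_orbitMap_eq (A := A) (p := g (Γ t)) hB.isHermitian hW
      (by rw [hF]; exact Matrix.isHermitian_diagonal_of_self_adjoint _ (by
        funext i; exact Complex.conj_ofReal _))
      (by rw [hF, hdet]) (by
        rw [hΛ, Matrix.det_diagonal]
        exact Finset.prod_ne_zero_iff.2 fun i _ => Complex.ofReal_ne_zero.2 (hμ i).ne')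
    have h0 : logSpectrum (A⁻¹ * B) = Finset.univ.val.map x := by
      rw [← hW, mul_assoc, logSpectrum_mul_comm, hΛ, logSpectrum_diagonal]
    rw [hlog, hF, hspec, h0]
    exact strictlyMajorized_combination x (abs_pos.2 ht0) (hmem t ht).2 hcsum hxc

/-! ### Splitting along the eigenspaces of a commuting Hermitian matrix -/

/-- In an eigenbasis of `N`, `p` selects one eigenspace; a matrix commuting with `N` has no entries
between different eigenvalues. -/
theorem exists_unitary_split {n : Type} [Fintype n] [DecidableEq n] {N : Matrix n n ℂ}
    (hN : N.IsHermitian) (hns : ¬ ∃ c : ℂ, N = c • (1 : Matrix n n ℂ)) :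
    ∃ V ∈ Matrix.unitaryGroup n ℂ, ∃ p : n → Prop, (∃ i, p i) ∧ (∃ i, ¬ p i) ∧
      ∀ M : Matrix n n ℂ, N * M = M * N → ∀ i j, p i → ¬ p j →
        (Vᴴ * M * V) i j = 0 ∧ (Vᴴ * M * V) j i = 0 := by
  obtain ⟨V, hV, ν, hν⟩ := hN.exists_diagonalization
  have h2 : V * Vᴴ = 1 := Matrix.mem_unitaryGroup_iff.1 hV
  have hne : ∃ i j, ν j ≠ ν i := by
    by_contra! hall
    rcases isEmpty_or_nonempty n with h | ⟨⟨i⟩⟩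
    · exact hns ⟨0, Subsingleton.elim _ _⟩
    · refine hns ⟨ν i, ?_⟩
      calc N = (V * Vᴴ) * N * (V * Vᴴ) := by simp [h2]
        _ = V * (Vᴴ * N * V) * Vᴴ := by simp only [mul_assoc]
        _ = V * ((ν i : ℂ) • (1 : Matrix n n ℂ)) * Vᴴ := by
          rw [hν, Matrix.smul_one_eq_diagonal]
          simp only [hall i]
        _ = (ν i : ℂ) • (1 : Matrix n n ℂ) := by simp [h2]
  obtain ⟨i₀, j₀, hij⟩ := hne
  refine ⟨V, hV, fun i => ν i = ν i₀, ⟨i₀, rfl⟩, ⟨j₀, hij⟩, fun M hM i j hi hj => ?_⟩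
  have hcomm : (Vᴴ * N * V) * (Vᴴ * M * V) = (Vᴴ * M * V) * (Vᴴ * N * V) := by
    calc (Vᴴ * N * V) * (Vᴴ * M * V) = Vᴴ * N * (V * Vᴴ) * M * V := by simp only [mul_assoc]
      _ = Vᴴ * (N * M) * V := by rw [h2]; simp only [mul_one, mul_assoc]
      _ = Vᴴ * M * (V * Vᴴ) * N * V := by rw [hM, h2]; simp only [mul_one, mul_assoc]
      _ = (Vᴴ * M * V) * (Vᴴ * N * V) := by simp only [mul_assoc]
  rw [hν] at hcomm
  have hz : ∀ k l, ν k ≠ ν l → (Vᴴ * M * V) k l = 0 := fun k l hkl => by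
    have h := congrFun (congrFun hcomm k) l
    rw [Matrix.diagonal_mul, Matrix.mul_diagonal] at h
    have hsub : ((ν k : ℂ) - ν l) * (Vᴴ * M * V) k l = 0 := by linear_combination h
    refine (mul_eq_zero.1 hsub).resolve_left fun h0 => hkl ?_
    exact_mod_cast sub_eq_zero.1 h0
  have hij : ν i ≠ ν j := fun h => hj (h.symm.trans hi)
  exact ⟨hz i j hij, hz j i hij.symm⟩

/-- The principal submatrix of the indices satisfying `p`. -/
abbrev principalBlock {n : Type} (p : n → Prop) (M : Matrix n n ℂ) :
    Matrix {i // p i} {i // p i} ℂ :=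
  M.submatrix Subtype.val Subtype.val

/-- The entries of `M` that couple `p` with its complement vanish. -/
def Decouples {n : Type} (p : n → Prop) (M : Matrix n n ℂ) : Prop :=
  ∀ i j, p i → ¬ p j → M i j = 0 ∧ M j i = 0

theorem Decouples.not {n : Type} {p : n → Prop} {M : Matrix n n ℂ} (h : Decouples p M) :
    Decouples (fun i => ¬ p i) M := fun i j hi hj => (h j i (not_not.1 hj) hi).symm

theorem Decouples.submatrix_sumCompl {n : Type} {p : n → Prop} [DecidablePred p]
    {M : Matrix n n ℂ} (h : Decouples p M) :
    M.submatrix (Equiv.sumCompl p) (Equiv.sumCompl p) =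
      Matrix.fromBlocks (principalBlock p M) 0 0 (principalBlock (fun i => ¬ p i) M) := by
  ext (i | i) (j | j)
  · rfl
  · exact (h i j i.2 j.2).1
  · exact (h j i j.2 i.2).2
  · rfl

theorem Matrix.PosDef.principalBlock {n : Type} {M : Matrix n n ℂ} (h : M.PosDef)
    (p : n → Prop) : (principalBlock p M).PosDef :=
  h.submatrix Subtype.val_injective

theorem Improvable.of_principalBlock {n : Type} [Fintype n] [DecidableEq n] {p : n → Prop}
    [DecidablePred p] {A B : Matrix n n ℂ} (hA : A.PosDef) (hAp : Decouples p A)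
    (hBp : Decouples p B) (h : Improvable (principalBlock p A) (principalBlock p B)) :
    Improvable A B := by
  refine Improvable.reindex (Equiv.sumCompl p) ?_
  rw [hAp.submatrix_sumCompl, hBp.submatrix_sumCompl]
  exact h.fromBlocks (hA.principalBlock p).isUnit (hA.principalBlock _).isUnit _

theorem Decouples.mul_comm_of_blocks {n : Type} [Fintype n] {p : n → Prop}
    [DecidablePred p] {A B : Matrix n n ℂ} (hAp : Decouples p A) (hBp : Decouples p B)
    (h : principalBlock p A * principalBlock p B = principalBlock p B * principalBlock p A)
    (h' : principalBlock (fun i => ¬ p i) A * principalBlock (fun i => ¬ p i) B =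
      principalBlock (fun i => ¬ p i) B * principalBlock (fun i => ¬ p i) A) :
    A * B = B * A := by
  let e := Equiv.sumCompl p
  have : (A * B).submatrix e e = (B * A).submatrix e e := by
    rw [← Matrix.submatrix_mul_equiv _ _ _ e, ← Matrix.submatrix_mul_equiv _ _ _ e,
      hAp.submatrix_sumCompl, hBp.submatrix_sumCompl, Matrix.fromBlocks_multiply,
      Matrix.fromBlocks_multiply, h, h']
    simp
  exact (Matrix.reindex e.symm e.symm).injective this

theorem improvable_of_not_commute {n : Type} [Fintype n] [DecidableEq n] {A B : Matrix n n ℂ}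
    (hA : A.PosDef) (hB : B.PosDef) (hAB : A * B ≠ B * A) : Improvable A B := by
  induction hk : Fintype.card n using Nat.strong_induction_on generalizing n with
  | _ k ih =>
  subst hk
  have : Nonempty n := by
    by_contra hempty
    rw [not_nonempty_iff] at hempty
    exact hAB (Subsingleton.elim _ _)
  by_cases hirr : ∀ N : Matrix n n ℂ, N.IsHermitian → N * A = A * N → N * B = B * N →
      ∃ c : ℂ, N = c • (1 : Matrix n n ℂ)
  · exact improvable_of_irreducible hA hB hAB hirr
  push Not at hirr
  obtain ⟨N, hN, hNA, hNB, hns⟩ := hirr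
  obtain ⟨V, hV, p, ⟨i, hi⟩, ⟨j, hj⟩, hsplit⟩ := exists_unitary_split hN (by simpa using hns)
  classical
  have hVu := isUnit_of_mem_unitaryGroup hV
  have hA' := hA.conj_of_isUnit hVu
  have hB' := hB.conj_of_isUnit hVu
  have hAp : Decouples p (Vᴴ * A * V) := hsplit A hNA
  have hBp : Decouples p (Vᴴ * B * V) := hsplit B hNB
  refine Improvable.conj hV ?_
  -- The blocks cannot both commute; the induction hypothesis is applied to one that does not.
  by_cases h1 : principalBlock p (Vᴴ * A * V) * principalBlock p (Vᴴ * B * V) =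
      principalBlock p (Vᴴ * B * V) * principalBlock p (Vᴴ * A * V)
  · refine Improvable.of_principalBlock hA' hAp.not hBp.not (ih _ ?_ (hA'.principalBlock _)
      (hB'.principalBlock _) (fun h2 => hAB ?_) rfl)
    · exact Fintype.card_subtype_lt (x := i) (not_not.2 hi)
    · have h3 := hAp.mul_comm_of_blocks hBp h1 h2
      have hVV : V * Vᴴ = 1 := Matrix.mem_unitaryGroup_iff.1 hV
      have h4 := congrArg (fun M => V * M * Vᴴ) h3
      have key : ∀ X Y : Matrix n n ℂ, V * (Vᴴ * X * V * (Vᴴ * Y * V)) * Vᴴ = X * Y := by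
        intro X Y
        calc _ = (V * Vᴴ) * X * (V * Vᴴ) * Y * (V * Vᴴ) := by simp only [mul_assoc]
          _ = X * Y := by simp [hVV]
      simpa only [key] using h4
  · exact Improvable.of_principalBlock hA' hAp hBp (ih _ (Fintype.card_subtype_lt hj)
      (hA'.principalBlock _) (hB'.principalBlock _) h1 rfl)

theorem exists_simultaneous_diagonalization {n : Type} [Fintype n] [DecidableEq n]
    {A B : Matrix n n ℂ} (hA : A.IsHermitian) (hB : B.IsHermitian) (hAB : A * B = B * A) :
    ∃ V ∈ Matrix.unitaryGroup n ℂ, ∃ a b : n → ℝ,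
      (Vᴴ * A * V = Matrix.diagonal fun i => (a i : ℂ)) ∧
      Vᴴ * B * V = Matrix.diagonal fun i => (b i : ℂ) := by
  induction hk : Fintype.card n using Nat.strong_induction_on generalizing n with
  | _ k ih =>
  subst hk
  -- For scalar `B` any diagonalization of `A` works; otherwise `B` itself supplies the splitting.
  by_cases hs : ∃ c : ℂ, B = c • (1 : Matrix n n ℂ)
  · obtain ⟨c, rfl⟩ := hs
    obtain ⟨V, hV, a, ha⟩ := hA.exists_diagonalization
    have h1 : Vᴴ * V = 1 := Matrix.mem_unitaryGroup_iff'.1 hV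
    rcases isEmpty_or_nonempty n with h | ⟨⟨i⟩⟩
    · exact ⟨V, hV, a, 0, ha, Subsingleton.elim _ _⟩
    refine ⟨V, hV, a, fun _ => c.re, ha, ?_⟩
    have hc : ((c.re : ℝ) : ℂ) = c := by
      have := congrFun (congrFun hB i) i
      exact Complex.conj_eq_iff_re.1 (by simpa using this)
    rw [Matrix.mul_smul, mul_one, Matrix.smul_mul, h1, Matrix.smul_one_eq_diagonal]
    simp only [hc]
  obtain ⟨V, hV, p, ⟨i, hi⟩, ⟨j, hj⟩, hsplit⟩ := exists_unitary_split hB hs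
  classical
  have hA' := Matrix.isHermitian_conjTranspose_mul_mul V hA
  have hB' := Matrix.isHermitian_conjTranspose_mul_mul V hB
  have hVV : V * Vᴴ = 1 := Matrix.mem_unitaryGroup_iff.1 hV
  have hAp : Decouples p (Vᴴ * A * V) := hsplit A hAB.symm
  have hBp : Decouples p (Vᴴ * B * V) := hsplit B rfl
  let e := Equiv.sumCompl p
  have hcomm : (Vᴴ * A * V).submatrix e e * (Vᴴ * B * V).submatrix e e
      = (Vᴴ * B * V).submatrix e e * (Vᴴ * A * V).submatrix e e := by
    have key : ∀ X Y : Matrix n n ℂ, Vᴴ * X * V * (Vᴴ * Y * V) = Vᴴ * (X * Y) * V := by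
      intro X Y
      calc _ = Vᴴ * X * (V * Vᴴ) * Y * V := by simp only [mul_assoc]
        _ = _ := by rw [hVV]; simp only [mul_one, mul_assoc]
    rw [Matrix.submatrix_mul_equiv, Matrix.submatrix_mul_equiv, key, key, hAB]
  rw [hAp.submatrix_sumCompl, hBp.submatrix_sumCompl, Matrix.fromBlocks_multiply,
    Matrix.fromBlocks_multiply, Matrix.fromBlocks_inj] at hcomm
  simp only [Matrix.zero_mul, add_zero, Matrix.mul_zero, zero_add] at hcomm
  obtain ⟨V₁, hV₁, a₁, b₁, ha₁, hb₁⟩ := ih _ (Fintype.card_subtype_lt hj) (hA'.submatrix _)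
    (hB'.submatrix _) hcomm.1 rfl
  obtain ⟨V₂, hV₂, a₂, b₂, ha₂, hb₂⟩ := ih _ (Fintype.card_subtype_lt (x := i) (not_not.2 hi))
    (hA'.submatrix _) (hB'.submatrix _) hcomm.2.2.2 rfl
  set W := (Matrix.fromBlocks V₁ 0 0 V₂).submatrix e.symm e.symm with hW
  have key : ∀ (M : Matrix n n ℂ) (x₁ : {i // p i} → ℝ) (x₂ : {i // ¬ p i} → ℝ), Decouples p M →
      (V₁ᴴ * principalBlock p M * V₁ = Matrix.diagonal fun i => (x₁ i : ℂ)) →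
      (V₂ᴴ * principalBlock (fun i => ¬ p i) M * V₂ = Matrix.diagonal fun i => (x₂ i : ℂ)) →
      Wᴴ * M * W = Matrix.diagonal fun i => ((Sum.elim x₁ x₂ (e.symm i) : ℝ) : ℂ) := by
    intro M x₁ x₂ hM h1 h2
    have hMe : M = (M.submatrix e e).submatrix e.symm e.symm := by simp
    rw [hMe, hM.submatrix_sumCompl, hW, Matrix.conjTranspose_submatrix,
      Matrix.submatrix_mul_equiv, Matrix.submatrix_mul_equiv, Matrix.fromBlocks_conjTranspose,
      Matrix.fromBlocks_multiply, Matrix.fromBlocks_multiply]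
    simp only [Matrix.conjTranspose_zero, Matrix.zero_mul, Matrix.mul_zero, add_zero, zero_add,
      h1, h2, Matrix.fromBlocks_diagonal, Matrix.submatrix_diagonal_equiv]
    congr 1
    funext k
    rcases h : e.symm k with l | l <;> simp [h]
  have hWu : W ∈ Matrix.unitaryGroup n ℂ := by
    have h1 : V₁ᴴ * V₁ = 1 := Matrix.mem_unitaryGroup_iff'.1 hV₁
    have h2 : V₂ᴴ * V₂ = 1 := Matrix.mem_unitaryGroup_iff'.1 hV₂
    rw [Matrix.mem_unitaryGroup_iff', Matrix.star_eq_conjTranspose, hW,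
      Matrix.conjTranspose_submatrix, Matrix.submatrix_mul_equiv, Matrix.fromBlocks_conjTranspose,
      Matrix.fromBlocks_multiply]
    simp [h1, h2]
  refine ⟨V * W, mul_mem hV hWu, fun i => Sum.elim a₁ a₂ (e.symm i),
    fun i => Sum.elim b₁ b₂ (e.symm i), ?_, ?_⟩
  · rw [← key _ a₁ a₂ hAp ha₁ ha₂, Matrix.conjTranspose_mul]
    simp only [mul_assoc]
  · rw [← key _ b₁ b₂ hBp hb₁ hb₂, Matrix.conjTranspose_mul]
    simp only [mul_assoc]

/-! ### Commuting pairs -/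

/-- Trace and determinant give the sums needed in `strictlyMajorized_pair` without computing
eigenvalues. -/
theorem exists_logSpectrum_eq {n : Type} [Fintype n] [DecidableEq n] {A B : Matrix n n ℂ}
    (hA : A.PosDef) (hB : B.PosDef) :
    ∃ x : n → ℝ, logSpectrum (A⁻¹ * B) = Finset.univ.val.map x ∧
      (A⁻¹ * B).trace = ((∑ i, Real.exp (x i) : ℝ) : ℂ) ∧
      (A⁻¹ * B).det = (Real.exp (∑ i, x i) : ℂ) := by
  obtain ⟨W, μ, hW, hμ, hΛ⟩ := exists_simultaneous_congruence hA hB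
  refine ⟨fun i => Real.log (μ i), ?_, ?_, ?_⟩
  · rw [← hW, mul_assoc, logSpectrum_mul_comm, hΛ, logSpectrum_diagonal]
  · rw [← hW, mul_assoc, Matrix.trace_mul_comm, hΛ, Matrix.trace_diagonal]
    simp only [Real.exp_log (hμ _), Complex.ofReal_sum]
  · rw [← hW, mul_assoc, Matrix.det_mul_comm, hΛ, Matrix.det_diagonal, Real.exp_sum]
    simp only [Real.exp_log (hμ _), Complex.ofReal_prod]

theorem rotation_mem_unitaryGroup (t : ℝ) :
    !![(Real.cos t : ℂ), -Real.sin t; Real.sin t, Real.cos t] ∈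
      Matrix.unitaryGroup (Fin 2) ℂ := by
  have h : (Real.cos t : ℂ) * Real.cos t + Real.sin t * Real.sin t = 1 := by
    rw [← sq, ← sq]; exact_mod_cast Real.cos_sq_add_sin_sq t
  rw [Matrix.mem_unitaryGroup_iff]
  ext i j
  fin_cases i <;> fin_cases j <;>
    simp only [Matrix.mul_apply, Fin.sum_univ_two, Matrix.star_apply, Complex.star_def, map_neg,
      Complex.conj_ofReal, Matrix.of_apply, Matrix.cons_val_zero, Matrix.cons_val_one,
      Matrix.cons_val', Matrix.cons_val_fin_one, Fin.zero_eta, Fin.mk_one, Matrix.one_apply_eq,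
      Fin.isValue, ne_eq, zero_ne_one, one_ne_zero, not_false_eq_true, Matrix.one_apply_ne] <;>
    first | linear_combination h | ring

theorem improvable_diagonal_fin_two {a b : Fin 2 → ℝ} (ha : ∀ i, 0 < a i) (hb : ∀ i, 0 < b i)
    (ha' : a 1 < a 0) (hb' : b 0 < b 1) :
    Improvable (Matrix.diagonal fun i => (a i : ℂ)) (Matrix.diagonal fun i => (b i : ℂ)) := by
  set A : Matrix (Fin 2) (Fin 2) ℂ := Matrix.diagonal fun i => (a i : ℂ) with hAdef
  set B : Matrix (Fin 2) (Fin 2) ℂ := Matrix.diagonal fun i => (b i : ℂ) with hBdef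
  have hA : A.PosDef := posDef_diagonal_ofReal_iff.2 ha
  have hB : B.PosDef := posDef_diagonal_ofReal_iff.2 hb
  have hAinv : A⁻¹ = Matrix.diagonal fun i => (((a i)⁻¹ : ℝ) : ℂ) := by
    refine Matrix.inv_eq_left_inv ?_
    rw [hAdef, Matrix.diagonal_mul_diagonal, ← Matrix.diagonal_one]
    congr 1
    funext i
    rw [← Complex.ofReal_mul, inv_mul_cancel₀ (ha i).ne', Complex.ofReal_one]
  let γ : ℝ → Matrix.unitaryGroup (Fin 2) ℂ := fun t => ⟨_, rotation_mem_unitaryGroup t⟩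
  -- Since `1 < π`, the sine vanishes only at `0` on this interval.
  refine ⟨1, one_pos, γ, ?_, ?_, fun t ht ht0 => ?_⟩
  · refine Continuous.continuousOn (Continuous.subtype_mk ?_ _)
    refine continuous_matrix fun i j => ?_
    fin_cases i <;> fin_cases j <;> simp <;> fun_prop
  · refine Subtype.ext ?_
    simp [γ, Matrix.one_fin_two]
  · have hγ := (γ t).2
    set R : Matrix (Fin 2) (Fin 2) ℂ := (γ t : Matrix (Fin 2) (Fin 2) ℂ) with hR
    have hR' : R = !![(Real.cos t : ℂ), -Real.sin t; Real.sin t, Real.cos t] := rfl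
    have hRR : R * Rᴴ = 1 := Matrix.mem_unitaryGroup_iff.1 hγ
    have hRB : (R * B * Rᴴ).PosDef := by
      have hu : IsUnit Rᴴ := IsUnit.of_mul_eq_one_right _ hRR
      simpa using hB.conj_of_isUnit hu
    obtain ⟨x, hx, hxt, hxd⟩ := exists_logSpectrum_eq hA hRB
    obtain ⟨y, hy, hyt, hyd⟩ := exists_logSpectrum_eq hA hB
    have hpair : ∀ z : Fin 2 → ℝ, Finset.univ.val.map z = {z 0, z 1} := fun z => rfl
    rw [hx, hy, hpair, hpair]
    refine strictlyMajorized_pair ?_ ?_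
    · have hdet : (A⁻¹ * (R * B * Rᴴ)).det = (A⁻¹ * B).det := by
        have h1 : R.det * Rᴴ.det = 1 := by rw [← Matrix.det_mul, hRR, Matrix.det_one]
        simp only [Matrix.det_mul]
        linear_combination (A⁻¹.det * B.det) * h1
      rw [hxd, hyd, Complex.ofReal_inj, Real.exp_eq_exp, Fin.sum_univ_two, Fin.sum_univ_two]
        at hdet
      exact hdet
    · have hsin : 0 < Real.sin t ^ 2 := by
        refine pow_pos ?_ 2 |>.trans_eq (sq_abs _)
        refine abs_pos.2 fun h => ht0 ?_
        have hpi := Real.pi_gt_three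
        exact (Real.sin_eq_zero_iff_of_lt_of_lt (by linarith [ht.1]) (by linarith [ht.2])).1 h
      have h1 : (A⁻¹ * (R * B * Rᴴ)).trace = (((a 0)⁻¹ * (Real.cos t ^ 2 * b 0 +
          Real.sin t ^ 2 * b 1) + (a 1)⁻¹ * (Real.sin t ^ 2 * b 0 +
          Real.cos t ^ 2 * b 1) : ℝ) : ℂ) := by
        rw [hAinv, hR', Matrix.trace_fin_two, Matrix.diagonal_mul, Matrix.diagonal_mul, hBdef]
        simp [Matrix.mul_apply, Fin.sum_univ_two, Matrix.vecMul_diagonal,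
          -Complex.ofReal_cos, -Complex.ofReal_sin]
        ring
      have h2 : (A⁻¹ * B).trace = (((a 0)⁻¹ * b 0 + (a 1)⁻¹ * b 1 : ℝ) : ℂ) := by
        rw [hAinv, hBdef, Matrix.diagonal_mul_diagonal, Matrix.trace_fin_two]
        simp
      rw [hxt, Complex.ofReal_inj, Fin.sum_univ_two] at h1
      rw [hyt, Complex.ofReal_inj, Fin.sum_univ_two] at h2
      rw [h1, h2, Real.cos_sq']
      have hinv : (a 0)⁻¹ < (a 1)⁻¹ := inv_strictAnti₀ (ha 1) ha'
      -- The trace drops by exactly this product, `sin² t * ((a 1)⁻¹ - (a 0)⁻¹) * (b 1 - b 0)`.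
      nlinarith [mul_pos hsin (mul_pos (sub_pos.2 hinv) (sub_pos.2 hb'))]

theorem improvable_diagonal {n : Type} [Fintype n] [DecidableEq n] {a b : n → ℝ}
    (ha : ∀ i, 0 < a i) (hb : ∀ i, 0 < b i) {i j : n} (haij : a j < a i) (hbij : b i < b j) :
    Improvable (Matrix.diagonal fun i => (a i : ℂ)) (Matrix.diagonal fun i => (b i : ℂ)) := by
  have hij : i ≠ j := fun h => by simp [h] at haij
  let p : n → Prop := fun k => k = i ∨ k = j
  have hdec : ∀ x : n → ℂ, Decouples p (Matrix.diagonal x) := fun x k l hk hl => by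
    have hkl : k ≠ l := fun h => hl (h ▸ hk)
    exact ⟨Matrix.diagonal_apply_ne _ hkl, Matrix.diagonal_apply_ne _ hkl.symm⟩
  refine Improvable.of_principalBlock (p := p) (posDef_diagonal_ofReal_iff.2 ha) (hdec _)
    (hdec _) ?_
  let f : Fin 2 → {k // p k} := ![⟨i, Or.inl rfl⟩, ⟨j, Or.inr rfl⟩]
  have hf : Function.Bijective f := by
    refine ⟨fun k l h => ?_, ?_⟩
    · fin_cases k <;> fin_cases l <;> simp_all [f, hij.symm]
    · rintro ⟨k, rfl | rfl⟩
      · exact ⟨0, rfl⟩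
      · exact ⟨1, rfl⟩
  refine Improvable.reindex (Equiv.ofBijective f hf) ?_
  have hsub : ∀ x : n → ℝ, (principalBlock p (Matrix.diagonal fun i => (x i : ℂ))).submatrix
      (Equiv.ofBijective f hf) (Equiv.ofBijective f hf) =
        Matrix.diagonal fun k => ((x (f k) : ℝ) : ℂ) := fun x => by
    rw [principalBlock, Matrix.submatrix_submatrix]
    exact Matrix.submatrix_diagonal _ _ (Subtype.val_injective.comp hf.1)
  rw [hsub, hsub]
  exact improvable_diagonal_fin_two (fun _ => ha _) (fun _ => hb _) haij hbij

/-! ### Similarly ordered commuting pairs, and the conclusion -/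

theorem logEigenvalues_eq_log {d : ℕ} {M : Matrix (Fin d) (Fin d) ℂ} {x : Fin d → ℝ}
    (hx : Antitone x) (h : M.charpoly.roots = Finset.univ.val.map fun i => (x i : ℂ)) :
    logEigenvalues M = fun i => Real.log (x i) := by
  have hl : eigenvalueList M = List.ofFn x := by
    have hperm : (eigenvalueList M).Perm (List.ofFn x) := by
      rw [← Multiset.coe_eq_coe, eigenvalueList, Multiset.sort_eq, h, Multiset.map_map,
        ← Fin.univ_val_map]
      simp
    refine hperm.eq_of_pairwise' (r := (· ≥ ·)) (Multiset.pairwise_sort _ _) ?_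
    rw [List.pairwise_ofFn]
    exact fun i j hij => hx hij.le
  funext i
  simp [logEigenvalues, eigenvaluesDesc, hl]

theorem charpoly_conj_of_mem_unitaryGroup {n : Type} [Fintype n] [DecidableEq n]
    {V : Matrix n n ℂ} (hV : V ∈ Matrix.unitaryGroup n ℂ) (M : Matrix n n ℂ) :
    (Vᴴ * M * V).charpoly = M.charpoly := by
  rw [Matrix.charpoly_mul_comm, ← mul_assoc, show V * Vᴴ = 1 from Matrix.mem_unitaryGroup_iff.1 hV,
    one_mul]

theorem logEigenvalues_eq_sortDesc {d : ℕ} {A B V : Matrix (Fin d) (Fin d) ℂ}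
    (hV : V ∈ Matrix.unitaryGroup (Fin d) ℂ) {a b : Fin d → ℝ}
    (ha : ∀ i, 0 < a i) (hb : ∀ i, 0 < b i)
    (hA : Vᴴ * A * V = Matrix.diagonal fun i => (a i : ℂ))
    (hB : Vᴴ * B * V = Matrix.diagonal fun i => (b i : ℂ))
    (hab : ∀ i j, a j < a i → b j ≤ b i) :
    logEigenvalues (A⁻¹ * B) = sortDesc (logEigenvalues B - logEigenvalues A) := by
  -- Sorting by `a + b` orders both vectors at once: under `hab`, an increase of one along `σ` would
  -- make the sum increase, even when the vectors have ties.
  set σ : Equiv.Perm (Fin d) := Tuple.sort fun i => -(a i + b i)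
  have hσ : ∀ i j, i ≤ j → a (σ j) + b (σ j) ≤ a (σ i) + b (σ i) := fun i j hij =>
    neg_le_neg_iff.1 (Tuple.monotone_sort (fun i => -(a i + b i)) hij)
  have haσ : Antitone (a ∘ σ) := fun i j hij => by
    by_contra! h
    have h : a (σ i) < a (σ j) := h
    linarith [hσ i j hij, hab _ _ h]
  have hbσ : Antitone (b ∘ σ) := fun i j hij => by
    by_contra! h
    have h : b (σ i) < b (σ j) := h
    have h2 : a (σ j) < a (σ i) := by linarith [hσ i j hij]
    linarith [hab _ _ h2]
  have hmap : ∀ (τ : Equiv.Perm (Fin d)) (x : Fin d → ℂ),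
      Finset.univ.val.map x = Finset.univ.val.map fun i => x (τ i) := fun τ x => by
    have h : Finset.univ.val.map τ = Finset.univ.val :=
      congrArg Finset.val (Finset.map_univ_equiv τ)
    rw [← h, Multiset.map_map, h]
    rfl
  have hlA : logEigenvalues A = fun i => Real.log (a (σ i)) :=
    logEigenvalues_eq_log haσ <| by
      rw [← charpoly_conj_of_mem_unitaryGroup hV, hA, roots_charpoly_diagonal]
      exact hmap σ _
  have hlB : logEigenvalues B = fun i => Real.log (b (σ i)) :=
    logEigenvalues_eq_log hbσ <| by
      rw [← charpoly_conj_of_mem_unitaryGroup hV, hB, roots_charpoly_diagonal]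
      exact hmap σ _
  have h2 : V * Vᴴ = 1 := Matrix.mem_unitaryGroup_iff.1 hV
  have hinv : Vᴴ * A⁻¹ * V = Matrix.diagonal fun i => ((a i)⁻¹ : ℂ) := by
    rw [← inv_conj_of_mem_unitaryGroup hV, hA]
    refine Matrix.inv_eq_left_inv ?_
    rw [Matrix.diagonal_mul_diagonal, ← Matrix.diagonal_one]
    congr 1
    funext i
    exact inv_mul_cancel₀ (Complex.ofReal_ne_zero.2 (ha i).ne')
  have hAB : Vᴴ * (A⁻¹ * B) * V = Matrix.diagonal fun i => ((b i / a i : ℝ) : ℂ) := by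
    calc Vᴴ * (A⁻¹ * B) * V = Vᴴ * A⁻¹ * (V * Vᴴ) * B * V := by
          rw [h2]; simp only [mul_one, mul_assoc]
      _ = (Vᴴ * A⁻¹ * V) * (Vᴴ * B * V) := by simp only [mul_assoc]
      _ = _ := by
        rw [hinv, hB, Matrix.diagonal_mul_diagonal]
        congr 1
        funext i
        push_cast
        rw [div_eq_inv_mul]
  set z := logEigenvalues B - logEigenvalues A with hz
  have hzi : ∀ i, Real.exp (z i) = b (σ i) / a (σ i) := fun i => by
    rw [hz, hlA, hlB, Pi.sub_apply, Real.exp_sub, Real.exp_log (ha _), Real.exp_log (hb _)]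
  rw [logEigenvalues_eq_log (x := fun i => Real.exp (sortDesc z i))]
  · simp
  · exact fun i j hij => Real.exp_le_exp.2 (sortDesc_antitone z hij)
  · rw [← charpoly_conj_of_mem_unitaryGroup hV, hAB, roots_charpoly_diagonal, hmap σ]
    simp only [← hzi]
    exact hmap (Fin.revPerm.trans (Tuple.sort z)) _

theorem theorem3p5 {d : ℕ} (A B : Matrix (Fin d) (Fin d) ℂ) (hA : A.PosDef) (hB : B.PosDef)
    (hne : logEigenvalues (A⁻¹ * B) ≠ sortDesc (logEigenvalues B - logEigenvalues A)) :
    ∃ t₀ : ℝ, 0 < t₀ ∧ ∃ γ : ℝ → Matrix.unitaryGroup (Fin d) ℂ,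
      ContinuousOn γ (Set.Ioo (-t₀) t₀) ∧ γ 0 = 1 ∧
      ∀ t ∈ Set.Ioo (-t₀) t₀, t ≠ 0 →
        logEigenvalues (A⁻¹ * ((γ t : Matrix (Fin d) (Fin d) ℂ) * B *
            (γ t : Matrix (Fin d) (Fin d) ℂ)ᴴ)) ≠ logEigenvalues (A⁻¹ * B) ∧
        Majorized
          (logEigenvalues (A⁻¹ * ((γ t : Matrix (Fin d) (Fin d) ℂ) * B *
            (γ t : Matrix (Fin d) (Fin d) ℂ)ᴴ)))
          (logEigenvalues (A⁻¹ * B)) := by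
  have himp : Improvable A B := by
    by_cases hAB : A * B = B * A
    · obtain ⟨V, hV, a, b, ha, hb⟩ :=
        exists_simultaneous_diagonalization hA.isHermitian hB.isHermitian hAB
      have hVu := isUnit_of_mem_unitaryGroup hV
      have hapos : ∀ i, 0 < a i := posDef_diagonal_ofReal_iff.1 (ha ▸ hA.conj_of_isUnit hVu)
      have hbpos : ∀ i, 0 < b i := posDef_diagonal_ofReal_iff.1 (hb ▸ hB.conj_of_isUnit hVu)
      by_cases hab : ∀ i j, a j < a i → b j ≤ b i
      · exact absurd (logEigenvalues_eq_sortDesc hV hapos hbpos ha hb hab) hne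
      · push Not at hab
        obtain ⟨i, j, haij, hbij⟩ := hab
        refine Improvable.conj hV ?_
        rw [ha, hb]
        exact improvable_diagonal hapos hbpos haij hbij
    · exact improvable_of_not_commute hA hB hAB
  obtain ⟨t₀, ht₀, γ, hγ, h0, h⟩ := himp
  refine ⟨t₀, ht₀, γ, hγ, h0, fun t ht ht0 => StrictlyMajorized.majorized ?_⟩
  rw [map_logEigenvalues, map_logEigenvalues]
  exact h t ht ht0
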